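/- Let $D_0=\{(x,y)\in\mathbb R^2: x^2+y^2<1\}$ and let \[ F(x,y,u,v)=\frac{\sqrt{u^2+v^2}+yu-xv}{1-(x^2+y^2)},\qquad (x,y)\in D_0,\ (u,v)\in\mathbb R^2, \] be the (anticlockwise) horocycle Randers metric. Then: 1. $F$ is a Finsler metric on $D_0$: on the slit tangent bundle it is smooth, positive and positively homogeneous of degree one in $(u,v)$, and its fundamental tensor $g_{ij}=\tfrac12\,\partial^2F^2/\partial y^i\partial y^j$ is positive definite (where $(y^1,y^2)=(u,v)$). 2. $F$ has constant flag curvature $+1$ on $D_0$ (not $-1$): $K(p,w,V)=1$ for every $p\in D_0$ and all linearly independent tangent vectors $w,V$, where $K(p,w,V)=\dfrac{g_w(R_wV,V)}{g_w(w,w)\,g_w(V,V)-g_w(w,V)^2}$ and $R_w$ is the Riemann curvature of the geodesic spray of $F$. 3. The Zermelo navigation data of $F$ on $D_0$ are $(h,W)$, where $h$ is the metric of the upper unit hemisphere $z=\sqrt{1-(x^2+y^2)}$ in $\mathbb R^3$ carried to $D_0$ by parallel projection along the $z$-axis, \[ h=\frac{(1-y^2)\,dx^2+2xy\,dx\,dy+(1-x^2)\,dy^2}{1-(x^2+y^2)},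 \] and $W=-y\,\partial_x+x\,\partial_y$ is the rotation field; that is, $h$ is a Riemannian metric, $h(W,W)<1$, and $h\!\left(\tfrac{w}{F(w)}-W,\tfrac{w}{F(w)}-W\right)=1$ for every nonzero tangent vector $w$. Moreover $W$ is a Killing field of $h$. 4. Consequently, in the other normalization $\tfrac12F=\dfrac{\sqrt{u^2+v^2}+yu-xv}{2(1-(x^2+y^2))}$ the metric is a Finsler metric on $D_0$ of constant flag curvature $4$. -/

import Mathlib

open scoped Matrix ContDiff

noncomputable section

namespace Finsler

/-! Finsler geometry on an open subset `U` of `ℝⁿ`, in the standard coordinates.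
A point of the tangent bundle is a pair `(x, y)`, with `x` the position and `y` the tangent vector. -/

/-- The partial derivative `∂f/∂xⁱ` of a function `f(x, y)` on the tangent bundle. -/
def pdx {n : ℕ} (i : Fin n) (f : (Fin n → ℝ) → (Fin n → ℝ) → ℝ) (x y : Fin n → ℝ) : ℝ :=
  fderiv ℝ (fun x' => f x' y) x (Pi.single i 1)

/-- The partial derivative `∂f/∂yⁱ` of a function `f(x, y)` on the tangent bundle. -/
def pdy {n : ℕ} (i : Fin n) (f : (Fin n → ℝ) → (Fin n → ℝ) → ℝ) (x y : Fin n → ℝ) : ℝ :=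
  fderiv ℝ (fun y' => f x y') y (Pi.single i 1)

/-- The fundamental tensor `g_ij = ½ ∂²(F²)/∂yⁱ∂yʲ`. -/
def fundamentalTensor {n : ℕ} (F : (Fin n → ℝ) → (Fin n → ℝ) → ℝ) (x y : Fin n → ℝ) :
    Matrix (Fin n) (Fin n) ℝ :=
  Matrix.of fun i j => (1 / 2) * pdy i (pdy j (fun x' y' => F x' y' ^ 2)) x y

/-- `F` is a Finsler metric on `U`: smooth, positive and positively homogeneous of degree one on
the slit tangent bundle, with positive definite fundamental tensor (strong convexity). -/
structure IsFinslerMetric {n : ℕ} (U : Set (Fin n → ℝ)) (F : (Fin n → ℝ) → (Fin n → ℝ) → ℝ) :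
    Prop where
  smooth : ContDiffOn ℝ ∞ (fun p : (Fin n → ℝ) × (Fin n → ℝ) => F p.1 p.2) (U ×ˢ {0}ᶜ)
  pos : ∀ x ∈ U, ∀ y, y ≠ 0 → 0 < F x y
  homogeneous : ∀ x ∈ U, ∀ y, ∀ c : ℝ, 0 < c → F x (c • y) = c * F x y
  posDef : ∀ x ∈ U, ∀ y, y ≠ 0 → (fundamentalTensor F x y).PosDef

/-- The geodesic spray coefficients
`Gⁱ = ¼ gⁱˡ (yᵏ ∂²(F²)/∂xᵏ∂yˡ - ∂(F²)/∂xˡ)`; the geodesics of `F` parametrised with constant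
speed are the solutions of `ẍⁱ + 2 Gⁱ(x, ẋ) = 0`. -/
def sprayCoeff {n : ℕ} (F : (Fin n → ℝ) → (Fin n → ℝ) → ℝ) (i : Fin n) (x y : Fin n → ℝ) : ℝ :=
  (1 / 4) * ∑ l, (fundamentalTensor F x y)⁻¹ i l *
    ((∑ k, y k * pdx k (pdy l (fun x' y' => F x' y' ^ 2)) x y)
      - pdx l (fun x' y' => F x' y' ^ 2) x y)

/-- The Riemann curvature (Jacobi endomorphism)
`Rⁱ_k = 2 ∂Gⁱ/∂xᵏ - yʲ ∂²Gⁱ/∂xʲ∂yᵏ + 2 Gʲ ∂²Gⁱ/∂yʲ∂yᵏ - ∂Gⁱ/∂yʲ ∂Gʲ/∂yᵏ`. -/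
def riemannCurvature {n : ℕ} (F : (Fin n → ℝ) → (Fin n → ℝ) → ℝ) (x y : Fin n → ℝ) :
    Matrix (Fin n) (Fin n) ℝ :=
  Matrix.of fun i k =>
    2 * pdx k (sprayCoeff F i) x y
      - (∑ j, y j * pdx j (pdy k (sprayCoeff F i)) x y)
      + 2 * (∑ j, sprayCoeff F j x y * pdy j (pdy k (sprayCoeff F i)) x y)
      - ∑ j, pdy j (sprayCoeff F i) x y * pdy k (sprayCoeff F j) x y

/-- The flag curvature of the flag with flagpole `y` and transverse edge `V`:
`K(x, y, V) = g_y(R_y V, V) / (g_y(y, y) g_y(V, V) - g_y(y, V)²)`. -/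
def flagCurvature {n : ℕ} (F : (Fin n → ℝ) → (Fin n → ℝ) → ℝ) (x y V : Fin n → ℝ) : ℝ :=
  (V ⬝ᵥ (fundamentalTensor F x y *ᵥ (riemannCurvature F x y *ᵥ V))) /
    ((y ⬝ᵥ (fundamentalTensor F x y *ᵥ y)) * (V ⬝ᵥ (fundamentalTensor F x y *ᵥ V))
      - (y ⬝ᵥ (fundamentalTensor F x y *ᵥ V)) ^ 2)

/-- `F` has constant flag curvature `κ` on `U`: all flags have flag curvature `κ`. -/
def HasConstantFlagCurvature {n : ℕ} (U : Set (Fin n → ℝ))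
    (F : (Fin n → ℝ) → (Fin n → ℝ) → ℝ) (κ : ℝ) : Prop :=
  ∀ x ∈ U, ∀ y V : Fin n → ℝ, LinearIndependent ℝ ![y, V] → flagCurvature F x y V = κ

/-- `h` is a (smooth) Riemannian metric on `U`, given by its matrix of components. -/
structure IsRiemannianMetric {n : ℕ} (U : Set (Fin n → ℝ))
    (h : (Fin n → ℝ) → Matrix (Fin n) (Fin n) ℝ) : Prop where
  smooth : ∀ i j, ContDiffOn ℝ ∞ (fun x => h x i j) U
  posDef : ∀ x ∈ U, (h x).PosDef

/-- `(h, W)` is the Zermelo navigation data of `F` on `U`: `h` is a Riemannian metric, `W` is a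
smooth vector field with `h(W, W) < 1`, and the indicatrix of `F` at each point is the unit
sphere of `h` translated by `W`, that is `h(y/F - W, y/F - W) = 1` for every `y ≠ 0`. -/
structure IsZermeloData {n : ℕ} (U : Set (Fin n → ℝ)) (F : (Fin n → ℝ) → (Fin n → ℝ) → ℝ)
    (h : (Fin n → ℝ) → Matrix (Fin n) (Fin n) ℝ) (W : (Fin n → ℝ) → (Fin n → ℝ)) : Prop where
  riemannian : IsRiemannianMetric U h
  smooth : ContDiffOn ℝ ∞ W U
  small : ∀ x ∈ U, W x ⬝ᵥ (h x *ᵥ W x) < 1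
  pos : ∀ x ∈ U, ∀ y, y ≠ 0 → 0 < F x y
  indicatrix : ∀ x ∈ U, ∀ y, y ≠ 0 →
    ((F x y)⁻¹ • y - W x) ⬝ᵥ (h x *ᵥ ((F x y)⁻¹ • y - W x)) = 1

/-- `W` is a Killing field of `h` on `U`: the Lie derivative
`(L_W h)_ij = Wᵏ ∂_k h_ij + h_kj ∂_i Wᵏ + h_ik ∂_j Wᵏ` vanishes. -/
def IsKillingField {n : ℕ} (U : Set (Fin n → ℝ))
    (h : (Fin n → ℝ) → Matrix (Fin n) (Fin n) ℝ) (W : (Fin n → ℝ) → (Fin n → ℝ)) : Prop :=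
  ∀ x ∈ U, ∀ i j,
    (∑ k, W x k * fderiv ℝ (fun x' => h x' i j) x (Pi.single k 1))
      + (∑ k, h x k j * fderiv ℝ (fun x' => W x' k) x (Pi.single i 1))
      + (∑ k, h x i k * fderiv ℝ (fun x' => W x' k) x (Pi.single j 1)) = 0

/-- The pullback to `ℝⁿ` of the Euclidean metric of `ℝᵐ` under a map `σ : ℝⁿ → ℝᵐ`. -/
def pullbackMetric {n m : ℕ} (σ : (Fin n → ℝ) → (Fin m → ℝ)) (x : Fin n → ℝ) :
    Matrix (Fin n) (Fin n) ℝ :=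
  Matrix.of fun i j =>
    fderiv ℝ σ x (Pi.single i 1) ⬝ᵥ fderiv ℝ σ x (Pi.single j 1)

/-- The open unit disk in `ℝ²` (Euclidean norm). -/
def unitDisk : Set (Fin 2 → ℝ) := {x | x 0 ^ 2 + x 1 ^ 2 < 1}

/-- The inverse of the parallel projection of the upper unit hemisphere in `ℝ³` along the third
axis onto the open unit disk. -/
def hemisphereLift (x : Fin 2 → ℝ) : Fin 3 → ℝ :=
  ![x 0, x 1, Real.sqrt (1 - (x 0 ^ 2 + x 1 ^ 2))]

/-- The generator of the anticlockwise rotations about the origin in `ℝ²`. -/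
def rotationField (x : Fin 2 → ℝ) : Fin 2 → ℝ := ![-x 1, x 0]

/-- The Randers metric of the anticlockwise horocycles in the Poincaré disk, at the point
`(x 0, x 1)` and the tangent vector `(y 0, y 1)`, normalised so that it is the Euclidean norm
at the origin. -/
def horocycleMetric (x y : Fin 2 → ℝ) : ℝ :=
  (Real.sqrt (y 0 ^ 2 + y 1 ^ 2) + (x 1 * y 0 - x 0 * y 1)) / (1 - (x 0 ^ 2 + x 1 ^ 2))

end Finsler

end

noncomputable section

namespace Finsler

/-! ### Partial derivatives -/

section Partial

variable {n : ℕ} {f g : (Fin n → ℝ) → (Fin n → ℝ) → ℝ} {x y : Fin n → ℝ}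

/-! Write r = |y|, D = 1 - |x|² and β = x₁y₀ - x₀y₁, so that F = (r + β)/D. Since β is linear in y,
the y-Hessian of F is that of r/D: it has rank one, with kernel spanned by y. Hence g = dF ⊗ dF + F
· Hess F (derivatives in y) is positive definite by Euler's identity.

The curvature becomes computable because the spray has a closed form, Gⁱ = F · (y₁, -y₀)ⁱ
(`sprayCoeff_horocycleMetric`): F times a constant linear map of y. Differentiating it gives R = F²
· 1 - y ⊗ F dF (`riemannCurvature_horocycleMetric`). As F dF = g_y(y, ·) and g_y(y, y) = F², the
numerator g_y(RV, V) is exactly the Gram determinant of y and V, so K = 1.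

For navigation, the hemisphere metric is h(v, v) = (|v|² - (x₁v₀ - x₀v₁)²)/D, and the translated
unit sphere condition reduces to (DF - β)² = r². Multiplying F by c leaves the spray and R unchanged
and scales g by c², so K scales by c⁻²; c = 1/2 gives 4. -/

theorem pdx_eq_of_hasFDerivAt {L : (Fin n → ℝ) →L[ℝ] ℝ} (i : Fin n)
    (h : HasFDerivAt (fun x' => f x' y) L x) : pdx i f x y = L (Pi.single i 1) := by
  rw [pdx, h.fderiv]

theorem pdy_eq_of_hasFDerivAt {L : (Fin n → ℝ) →L[ℝ] ℝ} (i : Fin n)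
    (h : HasFDerivAt (fun y' => f x y') L y) : pdy i f x y = L (Pi.single i 1) := by
  rw [pdy, h.fderiv]

/-- Closed formulas are available only over the disk and off the zero section. Both conditions are
open, so such formulas may be differentiated again. -/
theorem pdx_congr {U : Set (Fin n → ℝ)} (hU : IsOpen U) (h : ∀ x ∈ U, ∀ y, y ≠ 0 → f x y = g x y)
    (i : Fin n) : ∀ x ∈ U, ∀ y, y ≠ 0 → pdx i f x y = pdx i g x y := by
  intro x hx y hy
  have : (fun x' => f x' y) =ᶠ[nhds x] fun x' => g x' y := by
    filter_upwards [hU.mem_nhds hx] with x' hx' using h x' hx' y hy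
  rw [pdx, pdx, this.fderiv_eq]

theorem pdy_congr {U : Set (Fin n → ℝ)} (h : ∀ x ∈ U, ∀ y, y ≠ 0 → f x y = g x y)
    (i : Fin n) : ∀ x ∈ U, ∀ y, y ≠ 0 → pdy i f x y = pdy i g x y := by
  intro x hx y hy
  have : (fun y' => f x y') =ᶠ[nhds y] fun y' => g x y' := by
    filter_upwards [isOpen_ne.mem_nhds hy] with y' hy' using h x hx y' hy'
  rw [pdy, pdy, this.fderiv_eq]

theorem pdx_mul (i : Fin n) (hf : DifferentiableAt ℝ (fun x' => f x' y) x)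
    (hg : DifferentiableAt ℝ (fun x' => g x' y) x) :
    pdx i (fun x y => f x y * g x y) x y = pdx i f x y * g x y + f x y * pdx i g x y := by
  rw [pdx_eq_of_hasFDerivAt i (f := fun x y => f x y * g x y) (hf.hasFDerivAt.mul hg.hasFDerivAt)]
  simp [pdx]; ring

theorem pdy_mul (i : Fin n) (hf : DifferentiableAt ℝ (fun y' => f x y') y)
    (hg : DifferentiableAt ℝ (fun y' => g x y') y) :
    pdy i (fun x y => f x y * g x y) x y = pdy i f x y * g x y + f x y * pdy i g x y := by
  rw [pdy_eq_of_hasFDerivAt i (f := fun x y => f x y * g x y) (hf.hasFDerivAt.mul hg.hasFDerivAt)]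
  simp [pdy]; ring

theorem pdx_add (i : Fin n) (hf : DifferentiableAt ℝ (fun x' => f x' y) x)
    (hg : DifferentiableAt ℝ (fun x' => g x' y) x) :
    pdx i (fun x y => f x y + g x y) x y = pdx i f x y + pdx i g x y := by
  rw [pdx_eq_of_hasFDerivAt i (f := fun x y => f x y + g x y) (hf.hasFDerivAt.add hg.hasFDerivAt)]
  simp [pdx]

theorem pdy_add (i : Fin n) (hf : DifferentiableAt ℝ (fun y' => f x y') y)
    (hg : DifferentiableAt ℝ (fun y' => g x y') y) :
    pdy i (fun x y => f x y + g x y) x y = pdy i f x y + pdy i g x y := by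
  rw [pdy_eq_of_hasFDerivAt i (f := fun x y => f x y + g x y) (hf.hasFDerivAt.add hg.hasFDerivAt)]
  simp [pdy]

theorem pdx_const_mul (c : ℝ) (i : Fin n) (f : (Fin n → ℝ) → (Fin n → ℝ) → ℝ) :
    pdx i (fun x y => c * f x y) = fun x y => c * pdx i f x y := by
  funext x y
  simp only [pdx]
  have := congrFun (fderiv_const_smul_field (𝕜 := ℝ) (f := fun x' => f x' y) c) x
  exact congrArg (fun L : (Fin n → ℝ) →L[ℝ] ℝ => L (Pi.single i 1)) this

theorem pdy_const_mul (c : ℝ) (i : Fin n) (f : (Fin n → ℝ) → (Fin n → ℝ) → ℝ) :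
    pdy i (fun x y => c * f x y) = fun x y => c * pdy i f x y := by
  funext x y
  simp only [pdy]
  have := congrFun (fderiv_const_smul_field (𝕜 := ℝ) (f := fun y' => f x y') c) y
  exact congrArg (fun L : (Fin n → ℝ) →L[ℝ] ℝ => L (Pi.single i 1)) this

end Partial

/-! ### Rescaling a Finsler metric by a constant -/

section Rescaling

variable {n : ℕ} (F : (Fin n → ℝ) → (Fin n → ℝ) → ℝ) {c : ℝ}

theorem fundamentalTensor_const_mul (c : ℝ) (x y : Fin n → ℝ) :
    fundamentalTensor (fun x y => c * F x y) x y = c ^ 2 • fundamentalTensor F x y := by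
  ext i j
  simp only [fundamentalTensor, mul_pow, pdy_const_mul, Matrix.of_apply, Matrix.smul_apply,
    smul_eq_mul]
  ring

theorem inv_smul_of_ne_zero {k : ℝ} (hk : k ≠ 0) (A : Matrix (Fin n) (Fin n) ℝ) :
    (k • A)⁻¹ = k⁻¹ • A⁻¹ := by
  by_cases hA : IsUnit A.det
  · exact Matrix.inv_smul' A (Units.mk0 k hk) hA
  -- For singular A both inverses are zero by convention, so the scaling laws below need no
  -- nondegeneracy of g.
  · have hkA : ¬ IsUnit (k • A).det := by
      rw [Matrix.det_smul]
      simpa [isUnit_iff_ne_zero, hk] using hA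
    rw [Matrix.nonsing_inv_apply_not_isUnit _ hA, Matrix.nonsing_inv_apply_not_isUnit _ hkA,
      smul_zero]

theorem sprayCoeff_const_mul (hc : c ≠ 0) (i : Fin n) :
    sprayCoeff (fun x y => c * F x y) i = sprayCoeff F i := by
  funext x y
  simp only [sprayCoeff, fundamentalTensor_const_mul, inv_smul_of_ne_zero (pow_ne_zero 2 hc),
    mul_pow, pdy_const_mul, pdx_const_mul, Matrix.smul_apply, smul_eq_mul]
  congr 1
  refine Finset.sum_congr rfl fun l _ => ?_
  have : ∀ s : Fin n → ℝ, ∑ k, y k * (c ^ 2 * s k) = c ^ 2 * ∑ k, y k * s k := fun s => by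
    rw [Finset.mul_sum]; exact Finset.sum_congr rfl fun k _ => by ring
  rw [this]
  field_simp

theorem riemannCurvature_const_mul (hc : c ≠ 0) (x y : Fin n → ℝ) :
    riemannCurvature (fun x y => c * F x y) x y = riemannCurvature F x y := by
  simp only [riemannCurvature, sprayCoeff_const_mul F hc]

theorem flagCurvature_const_mul (hc : c ≠ 0) (x y V : Fin n → ℝ) :
    flagCurvature (fun x y => c * F x y) x y V = (c ^ 2)⁻¹ * flagCurvature F x y V := by
  simp only [flagCurvature, riemannCurvature_const_mul F hc, fundamentalTensor_const_mul,
    Matrix.smul_mulVec, dotProduct_smul, smul_eq_mul]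
  have : ∀ a b d e : ℝ, c ^ 2 * a * (c ^ 2 * b) - (c ^ 2 * d) ^ 2 =
      c ^ 2 * (c ^ 2 * (a * b - d ^ 2)) := fun a b d e => by ring
  rw [this _ _ _ 0, mul_div_mul_left _ _ (pow_ne_zero 2 hc), ← div_div, div_right_comm,
    div_eq_inv_mul]

variable {F} {U : Set (Fin n → ℝ)}

theorem IsFinslerMetric.const_mul (hF : IsFinslerMetric U F) (hc : 0 < c) :
    IsFinslerMetric U fun x y => c * F x y where
  smooth := contDiffOn_const.mul hF.smooth
  pos x hx y hy := mul_pos hc (hF.pos x hx y hy)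
  homogeneous x hx y t ht := by rw [hF.homogeneous x hx y t ht]; ring
  posDef x hx y hy := by
    rw [fundamentalTensor_const_mul]
    exact (hF.posDef x hx y hy).smul (pow_pos hc 2)

theorem HasConstantFlagCurvature.const_mul {κ : ℝ} (hF : HasConstantFlagCurvature U F κ)
    (hc : c ≠ 0) : HasConstantFlagCurvature U (fun x y => c * F x y) ((c ^ 2)⁻¹ * κ) :=
  fun x hx y V h => by rw [flagCurvature_const_mul F hc, hF x hx y V h]

end Rescaling

/-! ### Flag curvature in dimension two -/

/-- The Gram determinant is `A.det` times the squared area spanned by the two vectors; this makes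
the denominator of the flag curvature nonzero. -/
theorem gram_eq_det_mul_sq {A : Matrix (Fin 2) (Fin 2) ℝ} (hA : A.IsSymm) (v w : Fin 2 → ℝ) :
    (v ⬝ᵥ (A *ᵥ v)) * (w ⬝ᵥ (A *ᵥ w)) - (v ⬝ᵥ (A *ᵥ w)) ^ 2 =
      A.det * (v 0 * w 1 - v 1 * w 0) ^ 2 := by
  have h := hA.apply 0 1
  simp only [dotProduct, Matrix.mulVec, Fin.sum_univ_two, Matrix.det_fin_two, h]
  ring

theorem wedge_ne_zero_of_linearIndependent {v w : Fin 2 → ℝ} (h : LinearIndependent ℝ ![v, w]) :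
    v 0 * w 1 - v 1 * w 0 ≠ 0 := by
  have := Matrix.linearIndependent_rows_iff_isUnit (A := Matrix.of ![v, w]) |>.1 h
  rw [Matrix.isUnit_iff_isUnit_det, isUnit_iff_ne_zero, Matrix.det_fin_two] at this
  simpa using this

/-! ### The first and second derivatives of the horocycle metric -/

/-- The conformal denominator `1 - |x|²` of the disk. -/
def discFactor (x : Fin 2 → ℝ) : ℝ := 1 - (x 0 ^ 2 + x 1 ^ 2)

/-- The Euclidean norm of a vector in the plane. -/
def planeNorm (y : Fin 2 → ℝ) : ℝ := Real.sqrt (y 0 ^ 2 + y 1 ^ 2)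

/-- The partial derivative `∂F/∂xᵏ` of the horocycle metric. -/
def horocycleDx (k : Fin 2) (x y : Fin 2 → ℝ) : ℝ :=
  (![-y 1, y 0] k + 2 * x k * horocycleMetric x y) / discFactor x

/-- The partial derivative `∂F/∂yᵏ` of the horocycle metric. -/
def horocycleDy (k : Fin 2) (x y : Fin 2 → ℝ) : ℝ :=
  (y k / planeNorm y + ![x 1, -x 0] k) / discFactor x

variable {x y : Fin 2 → ℝ}

theorem isOpen_unitDisk : IsOpen unitDisk :=
  isOpen_lt (by fun_prop) continuous_const

theorem discFactor_pos (hx : x ∈ unitDisk) : 0 < discFactor x := sub_pos.2 hx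

theorem sq_add_sq_pos (hy : y ≠ 0) : 0 < y 0 ^ 2 + y 1 ^ 2 := by
  by_contra! h
  refine hy (funext fun i => ?_)
  have h0 : y 0 = 0 := by nlinarith [sq_nonneg (y 0), sq_nonneg (y 1)]
  have h1 : y 1 = 0 := by nlinarith [sq_nonneg (y 0), sq_nonneg (y 1)]
  fin_cases i <;> simp [h0, h1]

theorem planeNorm_pos (hy : y ≠ 0) : 0 < planeNorm y := Real.sqrt_pos.2 (sq_add_sq_pos hy)

theorem planeNorm_sq (y : Fin 2 → ℝ) : planeNorm y ^ 2 = y 0 ^ 2 + y 1 ^ 2 :=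
  Real.sq_sqrt (by positivity)

theorem horocycleMetric_eq (x y : Fin 2 → ℝ) : horocycleMetric x y =
    (planeNorm y + (x 1 * y 0 - x 0 * y 1)) / discFactor x := rfl

/-- The linear form on the plane with the given components. -/
def linForm (a : Fin 2 → ℝ) : (Fin 2 → ℝ) →L[ℝ] ℝ :=
  a 0 • ContinuousLinearMap.proj 0 + a 1 • ContinuousLinearMap.proj 1

theorem linForm_apply (a v : Fin 2 → ℝ) : linForm a v = a 0 * v 0 + a 1 * v 1 := rfl

theorem linForm_single (a : Fin 2 → ℝ) (k : Fin 2) : linForm a (Pi.single k 1) = a k := by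
  fin_cases k <;> simp [linForm_apply]

theorem hasFDerivAt_coord (i : Fin 2) (x : Fin 2 → ℝ) : HasFDerivAt (fun x : Fin 2 → ℝ => x i)
    (linForm (Pi.single i 1)) x := by
  refine (hasFDerivAt_apply (𝕜 := ℝ) i x).congr_fderiv ?_
  ext v
  fin_cases i <;> simp [linForm_apply]

/-- Quotient rule with dD = -2 x·dx, arranged so that the quotient itself reappears in its
derivative. It serves F, its y-derivatives and the entries of h. -/
theorem hasFDerivAt_div_discFactor {N : (Fin 2 → ℝ) → ℝ} {N' : Fin 2 → ℝ}
    (hN : HasFDerivAt N (linForm N') x) (hx : x ∈ unitDisk) :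
    HasFDerivAt (fun x => N x / discFactor x)
      (linForm fun k => (N' k + 2 * x k * (N x / discFactor x)) / discFactor x) x := by
  have hD := (discFactor_pos hx).ne'
  have h := (((hasFDerivAt_coord 0 x).pow 2).add ((hasFDerivAt_coord 1 x).pow 2)).const_sub 1
  have h2 := hN.mul ((hasDerivAt_inv (x := discFactor x) hD).comp_hasFDerivAt x h)
  refine (h2.congr_fderiv ?_).congr_of_eventuallyEq (.of_forall fun z => div_eq_mul_inv _ _)
  ext v
  simp [linForm_apply]
  field_simp
  ring

theorem hasFDerivAt_planeNorm (hy : y ≠ 0) :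
    HasFDerivAt planeNorm (linForm fun k => y k / planeNorm y) y := by
  have h := (((hasFDerivAt_coord 0 y).pow 2).add ((hasFDerivAt_coord 1 y).pow 2)).sqrt
    (sq_add_sq_pos hy).ne'
  refine h.congr_fderiv ?_
  have hr := (planeNorm_pos hy).ne'
  ext v
  change (1 / (2 * planeNorm y)) * _ = _
  simp [linForm_apply]
  field_simp

theorem hasFDerivAt_horocycleMetric_left (hx : x ∈ unitDisk) (y : Fin 2 → ℝ) :
    HasFDerivAt (fun x' => horocycleMetric x' y) (linForm fun k => horocycleDx k x y) x := by
  refine hasFDerivAt_div_discFactor ?_ hx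
  refine ((((hasFDerivAt_coord 1 x).mul_const (y 0)).sub
    ((hasFDerivAt_coord 0 x).mul_const (y 1))).const_add (planeNorm y)).congr_fderiv ?_
  ext v
  simp [linForm_apply]
  ring

theorem hasFDerivAt_horocycleMetric_right (x : Fin 2 → ℝ) (hy : y ≠ 0) :
    HasFDerivAt (fun y' => horocycleMetric x y') (linForm fun k => horocycleDy k x y) y := by
  refine (((hasFDerivAt_planeNorm hy).add (((hasFDerivAt_coord 0 y).const_mul (x 1)).sub
    ((hasFDerivAt_coord 1 y).const_mul (x 0)))).mul_const (discFactor x)⁻¹).congr_fderiv ?_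
  ext v
  simp [linForm_apply, horocycleDy]
  ring

theorem hasFDerivAt_horocycleDy_left (k : Fin 2) (hx : x ∈ unitDisk) (y : Fin 2 → ℝ) :
    HasFDerivAt (fun x' => horocycleDy k x' y) (linForm fun j =>
      (!![0, -1; 1, 0] j k + 2 * x j * horocycleDy k x y) / discFactor x) x := by
  refine hasFDerivAt_div_discFactor (HasFDerivAt.const_add _ ?_) hx
  fin_cases k
  · refine (hasFDerivAt_coord 1 x).congr_fderiv ?_
    ext v
    simp [linForm_apply]
  · refine (hasFDerivAt_coord 0 x).neg.congr_fderiv ?_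
    ext v
    simp [linForm_apply]

/-- The part β drops out, leaving the Hessian of the Euclidean norm, (y₁, -y₀) ⊗ (y₁, -y₀) / r³,
divided by D. -/
theorem hasFDerivAt_horocycleDy_right (k : Fin 2) (x : Fin 2 → ℝ) (hy : y ≠ 0) :
    HasFDerivAt (fun y' => horocycleDy k x y') (linForm fun j =>
      !![y 1 ^ 2, -(y 0 * y 1); -(y 0 * y 1), y 0 ^ 2] j k /
        (planeNorm y ^ 3 * discFactor x)) y := by
  have hr := (planeNorm_pos hy).ne'
  have hr2 := planeNorm_sq y
  refine ((((hasFDerivAt_coord k y).mul ((hasDerivAt_inv hr).comp_hasFDerivAt y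
    (hasFDerivAt_planeNorm hy))).add_const (![x 1, -x 0] k)).mul_const
      (discFactor x)⁻¹).congr_fderiv ?_
  ext v
  rw [linForm_apply, ← div_div, ← div_div, div_eq_mul_inv _ (discFactor x),
    div_eq_mul_inv _ (discFactor x)]
  fin_cases k <;> simp [linForm_apply] <;> field_simp <;> rw [hr2] <;> ring

theorem pdx_horocycleMetric (k : Fin 2) (hx : x ∈ unitDisk) (y : Fin 2 → ℝ) :
    pdx k horocycleMetric x y = horocycleDx k x y := by
  rw [pdx_eq_of_hasFDerivAt k (hasFDerivAt_horocycleMetric_left hx y), linForm_single]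

theorem pdy_horocycleMetric (k : Fin 2) (x : Fin 2 → ℝ) (hy : y ≠ 0) :
    pdy k horocycleMetric x y = horocycleDy k x y := by
  rw [pdy_eq_of_hasFDerivAt k (hasFDerivAt_horocycleMetric_right x hy), linForm_single]

theorem pdx_horocycleDy (j k : Fin 2) (hx : x ∈ unitDisk) (y : Fin 2 → ℝ) :
    pdx j (horocycleDy k) x y =
      (!![0, -1; 1, 0] j k + 2 * x j * horocycleDy k x y) / discFactor x := by
  rw [pdx_eq_of_hasFDerivAt j (hasFDerivAt_horocycleDy_left k hx y), linForm_single]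

theorem pdy_horocycleDy (j k : Fin 2) (x : Fin 2 → ℝ) (hy : y ≠ 0) :
    pdy j (horocycleDy k) x y =
      !![y 1 ^ 2, -(y 0 * y 1); -(y 0 * y 1), y 0 ^ 2] j k /
        (planeNorm y ^ 3 * discFactor x) := by
  rw [pdy_eq_of_hasFDerivAt j (hasFDerivAt_horocycleDy_right k x hy), linForm_single]

theorem horocycleMetric_pos (hx : x ∈ unitDisk) (hy : y ≠ 0) : 0 < horocycleMetric x y := by
  have hr := planeNorm_pos hy
  have hx' : x 0 ^ 2 + x 1 ^ 2 < 1 := hx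
  refine div_pos ?_ (discFactor_pos hx)
  change 0 < planeNorm y + (x 1 * y 0 - x 0 * y 1)
  -- Lagrange's identity: β² + (x·y)² = |x|² r², with |x| < 1.
  have : (x 1 * y 0 - x 0 * y 1) ^ 2 < planeNorm y ^ 2 := by
    have := planeNorm_sq y
    nlinarith [sq_nonneg (x 0 * y 0 + x 1 * y 1), sq_pos_of_pos hr]
  linarith [(abs_lt_of_sq_lt_sq' this hr.le).1]

/-! ### The fundamental tensor and the spray -/

theorem pdy_horocycleMetric_sq (k : Fin 2) (x : Fin 2 → ℝ) (hy : y ≠ 0) :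
    pdy k (fun x y => horocycleMetric x y ^ 2) x y =
      2 * (horocycleMetric x y * horocycleDy k x y) := by
  have h := (hasFDerivAt_horocycleMetric_right x hy).differentiableAt
  simp only [pow_two]
  rw [pdy_mul k h h, pdy_horocycleMetric k x hy]
  ring

theorem pdx_horocycleMetric_sq (k : Fin 2) (hx : x ∈ unitDisk) (y : Fin 2 → ℝ) :
    pdx k (fun x y => horocycleMetric x y ^ 2) x y =
      2 * (horocycleMetric x y * horocycleDx k x y) := by
  have h := (hasFDerivAt_horocycleMetric_left hx y).differentiableAt
  simp only [pow_two]
  rw [pdx_mul k h h, pdx_horocycleMetric k hx y]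
  ring

theorem fundamentalTensor_horocycleMetric (x : Fin 2 → ℝ) (hy : y ≠ 0) :
    fundamentalTensor horocycleMetric x y = Matrix.of fun i j =>
      horocycleDy i x y * horocycleDy j x y + horocycleMetric x y *
        (!![y 1 ^ 2, -(y 0 * y 1); -(y 0 * y 1), y 0 ^ 2] i j /
          (planeNorm y ^ 3 * discFactor x)) := by
  ext i j
  rw [fundamentalTensor, Matrix.of_apply, Matrix.of_apply,
    pdy_congr (U := Set.univ) (fun x _ y hy => pdy_horocycleMetric_sq j x hy) i x trivial y hy,
    pdy_const_mul]
  beta_reduce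
  rw [pdy_mul i (hasFDerivAt_horocycleMetric_right x hy).differentiableAt
      (hasFDerivAt_horocycleDy_right j x hy).differentiableAt, pdy_horocycleMetric i x hy,
    pdy_horocycleDy i j x hy]
  ring

theorem pdx_pdy_horocycleMetric_sq (j k : Fin 2) (hx : x ∈ unitDisk) (hy : y ≠ 0) :
    pdx j (pdy k fun x y => horocycleMetric x y ^ 2) x y =
      2 * (horocycleDx j x y * horocycleDy k x y + horocycleMetric x y *
        ((!![0, -1; 1, 0] j k + 2 * x j * horocycleDy k x y) / discFactor x)) := by
  rw [pdx_congr isOpen_unitDisk (fun x _ y hy => pdy_horocycleMetric_sq k x hy) j x hx y hy,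
    pdx_const_mul]
  beta_reduce
  rw [pdx_mul j (hasFDerivAt_horocycleMetric_left hx y).differentiableAt
      (hasFDerivAt_horocycleDy_left k hx y).differentiableAt, pdx_horocycleMetric j hx y,
    pdx_horocycleDy j k hx y]

/-- Euler's identity for the homogeneous function `F`. -/
theorem horocycleDy_mul_self_add (hx : x ∈ unitDisk) (hy : y ≠ 0) :
    horocycleDy 0 x y * y 0 + horocycleDy 1 x y * y 1 = horocycleMetric x y := by
  have hr := (planeNorm_pos hy).ne'
  have hD := (discFactor_pos hx).ne'
  simp only [horocycleDy, horocycleMetric_eq, Matrix.cons_val_zero, Matrix.cons_val_one]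
  field_simp
  linear_combination -planeNorm_sq y

theorem posDef_fundamentalTensor_horocycleMetric (hx : x ∈ unitDisk) (hy : y ≠ 0) :
    (fundamentalTensor horocycleMetric x y).PosDef := by
  have hF := horocycleMetric_pos hx hy
  have hr := planeNorm_pos hy
  have hD := discFactor_pos hx
  rw [fundamentalTensor_horocycleMetric x hy]
  refine Matrix.PosDef.of_dotProduct_mulVec_pos ?_ fun v hv => ?_
  · ext i j
    fin_cases i <;> fin_cases j <;> simp <;> ring
  have key : star v ⬝ᵥ ((Matrix.of fun i j =>
      horocycleDy i x y * horocycleDy j x y + horocycleMetric x y *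
        (!![y 1 ^ 2, -(y 0 * y 1); -(y 0 * y 1), y 0 ^ 2] i j /
          (planeNorm y ^ 3 * discFactor x))) *ᵥ v) =
      (horocycleDy 0 x y * v 0 + horocycleDy 1 x y * v 1) ^ 2 +
        horocycleMetric x y / (planeNorm y ^ 3 * discFactor x) * (y 1 * v 0 - y 0 * v 1) ^ 2 := by
    simp [dotProduct, Matrix.mulVec, Fin.sum_univ_two]
    ring
  rw [key]
  -- The second square vanishes only when v is parallel to y; the first is then nonzero, because
  -- dF(y) = F > 0. The two equations `e0` and `e1` are Cramer's rule, with Euler's identity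
  -- evaluating the determinant.
  by_cases h : y 1 * v 0 - y 0 * v 1 = 0
  · have hE := horocycleDy_mul_self_add hx hy
    have hL : horocycleDy 0 x y * v 0 + horocycleDy 1 x y * v 1 ≠ 0 := by
      intro h0
      refine hv (funext fun i => ?_)
      have e0 : horocycleMetric x y * v 0 = 0 := by
        linear_combination y 0 * h0 + horocycleDy 1 x y * h - v 0 * hE
      have e1 : horocycleMetric x y * v 1 = 0 := by
        linear_combination y 1 * h0 - horocycleDy 0 x y * h - v 1 * hE
      fin_cases i
      · exact (mul_eq_zero.1 e0).resolve_left hF.ne'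
      · exact (mul_eq_zero.1 e1).resolve_left hF.ne'
    rw [h]
    positivity
  · positivity

/-- The geodesics of constant speed `F` solve `ẍ = 2 F J ẋ`, with `J` the rotation by a right
angle. -/
theorem sprayCoeff_horocycleMetric (i : Fin 2) (hx : x ∈ unitDisk) (hy : y ≠ 0) :
    sprayCoeff horocycleMetric i x y = horocycleMetric x y * ![y 1, -y 0] i := by
  have hr := (planeNorm_pos hy).ne'
  have hD := (discFactor_pos hx).ne'
  have hr2 := planeNorm_sq y
  have hu : IsUnit (fundamentalTensor horocycleMetric x y).det :=
    isUnit_iff_ne_zero.2 (posDef_fundamentalTensor_horocycleMetric hx hy).det_pos.ne'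
  -- Instead of inverting g, apply g to the claimed spray and compare with the lowered coefficients;
  -- invertibility then finishes.
  have key : (fun l => (1 / 4) *
      ((∑ k, y k * pdx k (pdy l (fun x' y' => horocycleMetric x' y' ^ 2)) x y)
        - pdx l (fun x' y' => horocycleMetric x' y' ^ 2) x y)) =
      fundamentalTensor horocycleMetric x y *ᵥ (horocycleMetric x y • ![y 1, -y 0]) := by
    funext l
    simp only [pdx_pdy_horocycleMetric_sq _ _ hx hy, pdx_horocycleMetric_sq _ hx y,
      fundamentalTensor_horocycleMetric x hy, Matrix.mulVec, dotProduct, Fin.sum_univ_two]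
    fin_cases l <;>
      simp [horocycleDx, horocycleDy, horocycleMetric_eq] <;> field_simp <;> grind [discFactor]
  have h2 : sprayCoeff horocycleMetric i x y = ((fundamentalTensor horocycleMetric x y)⁻¹ *ᵥ
      (fun l => (1 / 4) *
      ((∑ k, y k * pdx k (pdy l (fun x' y' => horocycleMetric x' y' ^ 2)) x y)
        - pdx l (fun x' y' => horocycleMetric x' y' ^ 2) x y))) i := by
    rw [sprayCoeff, Finset.mul_sum, Matrix.mulVec, dotProduct]
    exact Finset.sum_congr rfl fun l _ => by ring
  rw [h2, key, Matrix.mulVec_mulVec, Matrix.nonsing_inv_mul _ hu, Matrix.one_mulVec]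
  rfl

/-! ### The flag curvature -/

theorem hasFDerivAt_rotate (i : Fin 2) (y : Fin 2 → ℝ) :
    HasFDerivAt (fun y : Fin 2 → ℝ => ![y 1, -y 0] i)
      (linForm fun k => !![0, -1; 1, 0] k i) y := by
  fin_cases i
  · refine (hasFDerivAt_coord 1 y).congr_fderiv ?_
    ext v
    simp [linForm_apply]
  · refine (hasFDerivAt_coord 0 y).neg.congr_fderiv ?_
    ext v
    simp [linForm_apply]

theorem pdy_rotate (i k : Fin 2) (x y : Fin 2 → ℝ) :
    pdy k (fun _ y => ![y 1, -y 0] i) x y = !![0, -1; 1, 0] k i := by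
  rw [pdy_eq_of_hasFDerivAt (f := fun _ y => ![y 1, -y 0] i) k (hasFDerivAt_rotate i y),
    linForm_single]

theorem pdx_sprayCoeff_horocycleMetric (i k : Fin 2) (hx : x ∈ unitDisk) (hy : y ≠ 0) :
    pdx k (sprayCoeff horocycleMetric i) x y = horocycleDx k x y * ![y 1, -y 0] i := by
  rw [pdx_congr isOpen_unitDisk (fun x hx y hy => sprayCoeff_horocycleMetric i hx hy) k x hx y hy,
    pdx_mul (g := fun _ y => ![y 1, -y 0] i) k
      (hasFDerivAt_horocycleMetric_left hx y).differentiableAt (differentiableAt_const _),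
    pdx_horocycleMetric k hx y]
  simp [pdx]

theorem pdy_sprayCoeff_horocycleMetric (i k : Fin 2) (hx : x ∈ unitDisk) (hy : y ≠ 0) :
    pdy k (sprayCoeff horocycleMetric i) x y =
      horocycleDy k x y * ![y 1, -y 0] i + horocycleMetric x y * !![0, -1; 1, 0] k i := by
  rw [pdy_congr (fun x hx y hy => sprayCoeff_horocycleMetric i hx hy) k x hx y hy,
    pdy_mul (g := fun _ y => ![y 1, -y 0] i) k
      (hasFDerivAt_horocycleMetric_right x hy).differentiableAt
      (hasFDerivAt_rotate i y).differentiableAt,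
    pdy_horocycleMetric k x hy, pdy_rotate]

theorem pdx_pdy_sprayCoeff_horocycleMetric (i j k : Fin 2) (hx : x ∈ unitDisk) (hy : y ≠ 0) :
    pdx j (pdy k (sprayCoeff horocycleMetric i)) x y =
      (!![0, -1; 1, 0] j k + 2 * x j * horocycleDy k x y) / discFactor x * ![y 1, -y 0] i +
        horocycleDx j x y * !![0, -1; 1, 0] k i := by
  have hF := (hasFDerivAt_horocycleMetric_left hx y).differentiableAt
  have hD := (hasFDerivAt_horocycleDy_left k hx y).differentiableAt
  rw [pdx_congr isOpen_unitDisk (fun x hx y hy => pdy_sprayCoeff_horocycleMetric i k hx hy)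
      j x hx y hy,
    pdx_add (f := fun x y => horocycleDy k x y * ![y 1, -y 0] i)
      (g := fun x y => horocycleMetric x y * !![0, -1; 1, 0] k i) j
      (hD.mul_const _) (hF.mul_const _),
    pdx_mul (g := fun _ y => ![y 1, -y 0] i) j hD (differentiableAt_const _),
    pdx_mul (g := fun _ _ => !![0, -1; 1, 0] k i) j hF (differentiableAt_const _),
    pdx_horocycleMetric j hx y, pdx_horocycleDy j k hx y]
  simp [pdx]

theorem pdy_pdy_sprayCoeff_horocycleMetric (i j k : Fin 2) (hx : x ∈ unitDisk) (hy : y ≠ 0) :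
    pdy j (pdy k (sprayCoeff horocycleMetric i)) x y =
      !![y 1 ^ 2, -(y 0 * y 1); -(y 0 * y 1), y 0 ^ 2] j k / (planeNorm y ^ 3 * discFactor x) *
        ![y 1, -y 0] i + horocycleDy k x y * !![0, -1; 1, 0] j i +
        horocycleDy j x y * !![0, -1; 1, 0] k i := by
  have hF := (hasFDerivAt_horocycleMetric_right x hy).differentiableAt
  have hD := (hasFDerivAt_horocycleDy_right k x hy).differentiableAt
  have hm := (hasFDerivAt_rotate i y).differentiableAt
  rw [pdy_congr (fun x hx y hy => pdy_sprayCoeff_horocycleMetric i k hx hy) j x hx y hy,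
    pdy_add (f := fun x y => horocycleDy k x y * ![y 1, -y 0] i)
      (g := fun x y => horocycleMetric x y * !![0, -1; 1, 0] k i) j
      (hD.mul hm) (hF.mul_const _),
    pdy_mul (g := fun _ y => ![y 1, -y 0] i) j hD hm,
    pdy_mul (g := fun _ _ => !![0, -1; 1, 0] k i) j hF (differentiableAt_const _),
    pdy_horocycleMetric j x hy, pdy_horocycleDy j k x hy, pdy_rotate]
  simp [pdy]

theorem riemannCurvature_horocycleMetric (hx : x ∈ unitDisk) (hy : y ≠ 0) :
    riemannCurvature horocycleMetric x y =
      horocycleMetric x y ^ 2 • (1 : Matrix (Fin 2) (Fin 2) ℝ) -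
        Matrix.vecMulVec y (fun k => horocycleMetric x y * horocycleDy k x y) := by
  have hr := (planeNorm_pos hy).ne'
  have hD := (discFactor_pos hx).ne'
  have hr2 := planeNorm_sq y
  ext i k
  simp only [riemannCurvature, Matrix.of_apply, pdx_sprayCoeff_horocycleMetric _ _ hx hy,
    pdy_sprayCoeff_horocycleMetric _ _ hx hy, pdx_pdy_sprayCoeff_horocycleMetric _ _ _ hx hy,
    pdy_pdy_sprayCoeff_horocycleMetric _ _ _ hx hy, sprayCoeff_horocycleMetric _ hx hy,
    Fin.sum_univ_two, Matrix.sub_apply, Matrix.smul_apply, Matrix.vecMulVec_apply, smul_eq_mul]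
  -- Once denominators are cleared, each entry is a polynomial identity modulo r² = y₀² + y₁² and
  -- the definition of D.
  fin_cases i <;> fin_cases k <;>
    simp [horocycleDx, horocycleDy, horocycleMetric_eq] <;> field_simp <;> grind [discFactor]

theorem fundamentalTensor_horocycleMetric_mulVec_self (hx : x ∈ unitDisk) (hy : y ≠ 0)
    (v : Fin 2 → ℝ) : v ⬝ᵥ (fundamentalTensor horocycleMetric x y *ᵥ y) =
      horocycleMetric x y * (horocycleDy 0 x y * v 0 + horocycleDy 1 x y * v 1) := by
  rw [fundamentalTensor_horocycleMetric x hy, ← horocycleDy_mul_self_add hx hy]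
  simp [dotProduct, Matrix.mulVec, Fin.sum_univ_two]
  ring

theorem hasConstantFlagCurvature_horocycleMetric :
    HasConstantFlagCurvature unitDisk horocycleMetric 1 := by
  intro x hx y V h
  have hy : y ≠ 0 := h.ne_zero 0
  have hg := posDef_fundamentalTensor_horocycleMetric hx hy
  have hsymm : (fundamentalTensor horocycleMetric x y).IsSymm := hg.isHermitian
  have hgram := gram_eq_det_mul_sq hsymm y V
  have hne : (fundamentalTensor horocycleMetric x y).det * (y 0 * V 1 - y 1 * V 0) ^ 2 ≠ 0 :=
    mul_ne_zero hg.det_pos.ne' (pow_ne_zero 2 (wedge_ne_zero_of_linearIndependent h))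
  have hcomm : y ⬝ᵥ (fundamentalTensor horocycleMetric x y *ᵥ V) =
      V ⬝ᵥ (fundamentalTensor horocycleMetric x y *ᵥ y) := by
    rw [Matrix.dotProduct_mulVec, ← Matrix.mulVec_transpose, hsymm.eq, dotProduct_comm]
  rw [flagCurvature, div_eq_one_iff_eq (hgram ▸ hne), hcomm,
    riemannCurvature_horocycleMetric hx hy, Matrix.sub_mulVec, Matrix.smul_mulVec,
    Matrix.one_mulVec, Matrix.vecMulVec_mulVec, Matrix.mulVec_sub, Matrix.mulVec_smul,
    dotProduct_sub, dotProduct_smul, op_smul_eq_smul, Matrix.mulVec_smul, dotProduct_smul,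
    fundamentalTensor_horocycleMetric_mulVec_self hx hy,
    fundamentalTensor_horocycleMetric_mulVec_self hx hy, horocycleDy_mul_self_add hx hy]
  simp only [dotProduct, Fin.sum_univ_two, smul_eq_mul]
  ring

theorem isFinslerMetric_horocycleMetric : IsFinslerMetric unitDisk horocycleMetric where
  smooth := by
    rintro ⟨x, y⟩ ⟨hx, hy⟩
    have h1 : y 0 ^ 2 + y 1 ^ 2 ≠ 0 := (sq_add_sq_pos hy).ne'
    have h2 : 1 - (x 0 ^ 2 + x 1 ^ 2) ≠ 0 := (discFactor_pos hx).ne'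
    refine ContDiffAt.contDiffWithinAt ?_
    unfold horocycleMetric
    refine ContDiffAt.div (ContDiffAt.add (ContDiffAt.sqrt ?_ h1) ?_) ?_ h2 <;> fun_prop
  pos _ hx _ hy := horocycleMetric_pos hx hy
  homogeneous x _ y c hc := by
    have : Real.sqrt ((c * y 0) ^ 2 + (c * y 1) ^ 2) = c * Real.sqrt (y 0 ^ 2 + y 1 ^ 2) := by
      rw [mul_pow, mul_pow, ← mul_add, Real.sqrt_mul (sq_nonneg c), Real.sqrt_sq hc.le]
    simp only [horocycleMetric, Pi.smul_apply, smul_eq_mul, this]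
    ring
  posDef _ hx _ hy := posDef_fundamentalTensor_horocycleMetric hx hy

/-! ### The Zermelo navigation data -/

/-- On the hemisphere z² = D, so dz = -(x·dx)/z and h = |dx|² + (x·dx)²/D. -/
theorem pullbackMetric_hemisphereLift (hx : x ∈ unitDisk) : pullbackMetric hemisphereLift x =
    (1 - (x 0 ^ 2 + x 1 ^ 2))⁻¹ • !![1 - x 1 ^ 2, x 0 * x 1; x 0 * x 1, 1 - x 0 ^ 2] := by
  have hD : 0 < 1 - (x 0 ^ 2 + x 1 ^ 2) := discFactor_pos hx
  have hz := Real.sq_sqrt hD.le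
  have hs : HasFDerivAt (fun x : Fin 2 → ℝ => Real.sqrt (1 - (x 0 ^ 2 + x 1 ^ 2)))
      (linForm fun k => -x k / Real.sqrt (1 - (x 0 ^ 2 + x 1 ^ 2))) x := by
    refine ((((hasFDerivAt_coord 0 x).pow 2).add
      ((hasFDerivAt_coord 1 x).pow 2)).const_sub 1).sqrt hD.ne' |>.congr_fderiv ?_
    have := (Real.sqrt_pos.2 hD).ne'
    ext v
    simp [linForm_apply]
    field_simp
    ring
  have hσ : HasFDerivAt hemisphereLift (ContinuousLinearMap.pi ![linForm (Pi.single 0 1),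
      linForm (Pi.single 1 1), linForm fun k => -x k / Real.sqrt (1 - (x 0 ^ 2 + x 1 ^ 2))]) x := by
    rw [hasFDerivAt_pi']
    intro i
    fin_cases i
    · exact hasFDerivAt_coord 0 x
    · exact hasFDerivAt_coord 1 x
    · exact hs
  have hz0 := (Real.sqrt_pos.2 hD).ne'
  ext i j
  rw [pullbackMetric, Matrix.of_apply, hσ.fderiv]
  fin_cases i <;> fin_cases j <;>
    simp [dotProduct, Fin.sum_univ_succ, linForm_single] <;>
    field_simp <;> rw [hz] <;> field_simp <;> ring

/-- Lagrange's identity turns D|v|² + (x·v)² into |v|² - (x₁v₀ - x₀v₁)², exposing the same linear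
form β as in F. -/
theorem dotProduct_pullbackMetric_hemisphereLift (hx : x ∈ unitDisk) (v : Fin 2 → ℝ) :
    v ⬝ᵥ (pullbackMetric hemisphereLift x *ᵥ v) =
      (v 0 ^ 2 + v 1 ^ 2 - (x 1 * v 0 - x 0 * v 1) ^ 2) / discFactor x := by
  rw [pullbackMetric_hemisphereLift hx, discFactor]
  simp [dotProduct, Matrix.mulVec, Fin.sum_univ_two]
  ring

theorem isRiemannianMetric_hemisphere :
    IsRiemannianMetric unitDisk (pullbackMetric hemisphereLift) where
  smooth i j := by
    have : ContDiffOn ℝ ∞ (fun x : Fin 2 → ℝ => ((1 - (x 0 ^ 2 + x 1 ^ 2))⁻¹ •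
        !![1 - x 1 ^ 2, x 0 * x 1; x 0 * x 1, 1 - x 0 ^ 2] : Matrix _ _ ℝ) i j) unitDisk := by
      intro x hx
      have h : 1 - (x 0 ^ 2 + x 1 ^ 2) ≠ 0 := (discFactor_pos hx).ne'
      refine ContDiffAt.contDiffWithinAt ?_
      refine ContDiffAt.mul (ContDiffAt.inv (by fun_prop) h) ?_
      fin_cases i <;> fin_cases j <;> simp <;> fun_prop
    exact this.congr fun x hx => by rw [pullbackMetric_hemisphereLift hx]
  posDef x hx := by
    have hD := discFactor_pos hx
    refine Matrix.PosDef.of_dotProduct_mulVec_pos ?_ fun v hv => ?_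
    · rw [pullbackMetric_hemisphereLift hx]
      ext i j
      fin_cases i <;> fin_cases j <;> simp
    · have : star v = v := rfl
      rw [this, dotProduct_pullbackMetric_hemisphereLift hx]
      refine div_pos ?_ hD
      have hx' : x 0 ^ 2 + x 1 ^ 2 < 1 := hx
      nlinarith [sq_nonneg (x 0 * v 0 + x 1 * v 1), sq_add_sq_pos hv]

theorem isZermeloData_horocycleMetric :
    IsZermeloData unitDisk horocycleMetric (pullbackMetric hemisphereLift) rotationField where
  riemannian := isRiemannianMetric_hemisphere
  smooth := by
    refine ContDiff.contDiffOn (contDiff_pi.2 fun i => ?_)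
    fin_cases i <;> simp [rotationField] <;> fun_prop
  small x hx := by
    rw [dotProduct_pullbackMetric_hemisphereLift hx, div_lt_one (discFactor_pos hx)]
    have hx' : x 0 ^ 2 + x 1 ^ 2 < 1 := hx
    simp only [rotationField, discFactor, Matrix.cons_val_zero, Matrix.cons_val_one]
    -- Here h(W, W) = |x|², so the claim is |x|² D < D.
    nlinarith
  pos _ hx _ hy := horocycleMetric_pos hx hy
  indicatrix x hx y hy := by
    have hF := (horocycleMetric_pos hx hy).ne'
    have hD := (discFactor_pos hx).ne'
    have hr2 := planeNorm_sq y
    have hFr : discFactor x * horocycleMetric x y =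
        planeNorm y + (x 1 * y 0 - x 0 * y 1) := by
      rw [horocycleMetric_eq, mul_div_cancel₀ _ hD]
    rw [dotProduct_pullbackMetric_hemisphereLift hx, div_eq_one_iff_eq hD]
    simp only [rotationField, Pi.sub_apply, Pi.smul_apply, smul_eq_mul, Matrix.cons_val_zero,
      Matrix.cons_val_one]
    field_simp
    rw [discFactor] at hFr ⊢
    -- The goal amounts to (DF - β)² = r²; the coefficient of `hFr` is the cofactor DF - β + r in
    -- this difference of squares.
    linear_combination -hr2 - (horocycleMetric x y * (1 - (x 0 ^ 2 + x 1 ^ 2)) -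
      (x 1 * y 0 - x 0 * y 1) + planeNorm y) * hFr

theorem isKillingField_rotationField :
    IsKillingField unitDisk (pullbackMetric hemisphereLift) rotationField := by
  intro x hx i j
  have hD := (discFactor_pos hx).ne'
  -- The nested array holds the gradients of the numerators of the entries of h.
  have hh : ∀ i j k, fderiv ℝ (fun x' => pullbackMetric hemisphereLift x' i j) x (Pi.single k 1) =
      (!![![0, -2 * x 1], ![x 1, x 0]; ![x 1, x 0], ![-2 * x 0, 0]] i j k + 2 * x k *
        (!![1 - x 1 ^ 2, x 0 * x 1; x 0 * x 1, 1 - x 0 ^ 2] i j / discFactor x)) /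
          discFactor x := by
    intro i j k
    have he : (fun x' => pullbackMetric hemisphereLift x' i j) =ᶠ[nhds x] fun x' =>
        !![1 - x' 1 ^ 2, x' 0 * x' 1; x' 0 * x' 1, 1 - x' 0 ^ 2] i j / discFactor x' := by
      filter_upwards [isOpen_unitDisk.mem_nhds hx] with x' hx'
      rw [pullbackMetric_hemisphereLift hx', Matrix.smul_apply, smul_eq_mul, div_eq_inv_mul]
      rfl
    have hN : HasFDerivAt (fun x' : Fin 2 → ℝ =>
        !![1 - x' 1 ^ 2, x' 0 * x' 1; x' 0 * x' 1, 1 - x' 0 ^ 2] i j)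
        (linForm (!![![0, -2 * x 1], ![x 1, x 0]; ![x 1, x 0], ![-2 * x 0, 0]] i j)) x := by
      have h0 := hasFDerivAt_coord 0 x
      have h1 := hasFDerivAt_coord 1 x
      fin_cases i <;> fin_cases j
      · refine ((h1.pow 2).const_sub 1).congr_fderiv ?_
        ext v; simp [linForm_apply]
      · refine (h0.mul h1).congr_fderiv ?_
        ext v; simp [linForm_apply]; ring
      · refine (h0.mul h1).congr_fderiv ?_
        ext v; simp [linForm_apply]; ring
      · refine ((h0.pow 2).const_sub 1).congr_fderiv ?_
        ext v; simp [linForm_apply]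
    rw [he.fderiv_eq, (hasFDerivAt_div_discFactor hN hx).fderiv, linForm_single]
  have hW : ∀ k i, fderiv ℝ (fun x' => rotationField x' k) x (Pi.single i 1) =
      !![0, -1; 1, 0] k i := by
    intro k i
    have : HasFDerivAt (fun x' => rotationField x' k) (linForm (!![0, -1; 1, 0] k)) x := by
      fin_cases k
      · refine (hasFDerivAt_coord 1 x).neg.congr_fderiv ?_
        ext v; simp [linForm_apply]
      · refine (hasFDerivAt_coord 0 x).congr_fderiv ?_
        ext v; simp [linForm_apply]
    rw [this.fderiv, linForm_single]
  have hx0 : rotationField x 0 = -x 1 := rfl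
  have hx1 : rotationField x 1 = x 0 := rfl
  have hDe : 1 - (x 0 ^ 2 + x 1 ^ 2) = discFactor x := rfl
  simp only [hh, hW, pullbackMetric_hemisphereLift hx, Fin.sum_univ_two, hx0, hx1, hDe,
    Matrix.smul_apply]
  fin_cases i <;> fin_cases j <;> simp <;> field_simp <;> ring

end Finsler

end

theorem mainTheorem4 :
    -- the horocycle metric is a Finsler metric of constant flag curvature 1 on the unit disk
    Finsler.IsFinslerMetric Finsler.unitDisk Finsler.horocycleMetric ∧
    Finsler.HasConstantFlagCurvature Finsler.unitDisk Finsler.horocycleMetric 1 ∧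
    -- its Zermelo navigation data: the hemisphere metric and the rotation field
    Finsler.IsZermeloData Finsler.unitDisk Finsler.horocycleMetric
      (Finsler.pullbackMetric Finsler.hemisphereLift) Finsler.rotationField ∧
    (∀ x ∈ Finsler.unitDisk, Finsler.pullbackMetric Finsler.hemisphereLift x =
      (1 - (x 0 ^ 2 + x 1 ^ 2))⁻¹ • !![1 - x 1 ^ 2, x 0 * x 1; x 0 * x 1, 1 - x 0 ^ 2]) ∧
    Finsler.IsKillingField Finsler.unitDisk
      (Finsler.pullbackMetric Finsler.hemisphereLift) Finsler.rotationField ∧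
    -- one half of the metric, i.e. the normalisation with denominator 2(1 - (x² + y²))
    Finsler.IsFinslerMetric Finsler.unitDisk (fun x y => (1 / 2) * Finsler.horocycleMetric x y) ∧
    Finsler.HasConstantFlagCurvature Finsler.unitDisk
      (fun x y => (1 / 2) * Finsler.horocycleMetric x y) 4 := by
  refine ⟨Finsler.isFinslerMetric_horocycleMetric,
    Finsler.hasConstantFlagCurvature_horocycleMetric, Finsler.isZermeloData_horocycleMetric,
    fun x hx => Finsler.pullbackMetric_hemisphereLift hx, Finsler.isKillingField_rotationField,
    Finsler.isFinslerMetric_horocycleMetric.const_mul (by norm_num), ?_⟩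
  have := Finsler.hasConstantFlagCurvature_horocycleMetric.const_mul
    (c := 1 / 2) (by norm_num)
  norm_num at this ⊢
  exact this
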